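/- Let $X$ be the multiplication operator $(Xf)(x)=x f(x)$ on $L^2(\mathbb{R},\mathbb{C})$ with domain $\{f\in L^2(\mathbb{R},\mathbb{C}) : \int_{\mathbb{R}} x^2|f(x)|^2\,dx<\infty\}$, let $\Phi(x)=\pi^{-1/4}e^{-x^2/2}$, and let $T=\sqrt2\,X$. A self-adjoint operator $A$ has, in the state $\Phi$, the characteristic function $t\mapsto\langle \Phi,e^{itA}\Phi\rangle$, $t\in\mathbb{R}$, where $(e^{itA})_{t\in\mathbb{R}}$ is the strongly continuous one-parameter unitary group with infinitesimal generator $iA$. Then $T$ is $\mathcal N(0,1)$-distributed in the state $\Phi$, that is, its characteristic function is that of the standard Gaussian distribution, $e^{-t^2/2}$, and for every $t\in\mathbb{R}$ the characteristic function of the cube $T^3$ (taken with its natural domain; the group $e^{itT^3}$ exists) is $$\langle \Phi, e^{itT^3}\Phi\rangle=\begin{cases}\dfrac{1}{3|t|\sqrt{6\pi}}\;e^{\frac{1}{108t^2}}\;K_{1/3}\!\left(\dfrac{1}{108t^2}\right), & t\neq 0,\\[2mm] 1, & t=0,\end{cases}$$ where $K_\nu$ is the modified Bessel function of the second kind, $K_\nu(z)=\int_0^\infty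 e^{-z\cosh u}\cosh(\nu u)\,du$ for $z>0$. Likewise, for every classical random variable $Z\sim\mathcal N(0,1)$ on a probability space, $\mathbb E\big[e^{itZ^3}\big]$ is given by the same formula for every $t\in\mathbb{R}$. -/

import Mathlib

open MeasureTheory ProbabilityTheory

noncomputable section

/-- The modified Bessel function of the second kind `K_ν(z)`, for real order `ν` and real argument
`z > 0`: `K_ν(z) = ∫_0^∞ exp (-z cosh u) cosh (ν u) du`.
The integral converges absolutely for every `z > 0`. -/
def besselK (ν z : ℝ) : ℝ :=
  ∫ u in Set.Ioi (0 : ℝ), Real.exp (-z * Real.cosh u) * Real.cosh (ν * u)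

/-- The Hilbert space `L²(ℝ, ℂ)`, with inner product `⟪f, g⟫ = ∫ conj (f x) * g x dx`. -/
abbrev L2R : Type := Lp ℂ 2 (volume : Measure ℝ)

/-- The position operator `X`, that is `(X f)(x) = x f(x)`, with its maximal domain
`{f ∈ L² : x f(x) ∈ L²}`. -/
def positionOp : L2R →ₗ.[ℂ] L2R where
  domain :=
    { carrier := {f | MemLp (fun x : ℝ => (x : ℂ) * f x) 2 volume}
      add_mem' := by
        intro f g hf hg
        refine (MemLp.add hf hg).ae_eq ?_
        filter_upwards [Lp.coeFn_add f g] with x hx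
        simp only [Pi.add_apply, hx]
        ring
      zero_mem' := by
        refine (MemLp.zero' (ε := ℂ) (p := 2) (μ := (volume : Measure ℝ))).ae_eq ?_
        filter_upwards [Lp.coeFn_zero ℂ 2 (volume : Measure ℝ)] with x hx
        rw [hx, Pi.zero_apply, mul_zero]
      smul_mem' := by
        intro c f hf
        refine (MemLp.const_smul hf c).ae_eq ?_
        filter_upwards [Lp.coeFn_smul c f] with x hx
        simp only [Pi.smul_apply, hx, smul_eq_mul]
        ring }
  toFun :=
    { toFun := fun f => MemLp.toLp (fun x : ℝ => (x : ℂ) * (f : L2R) x) f.2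
      map_add' := by
        intro f g
        rw [← MemLp.toLp_add]
        refine MemLp.toLp_congr _ _ ?_
        filter_upwards [Lp.coeFn_add (f : L2R) (g : L2R)] with x hx
        simp only [Submodule.coe_add, Pi.add_apply, hx]
        ring
      map_smul' := by
        intro c f
        rw [RingHom.id_apply, ← MemLp.toLp_const_smul]
        refine MemLp.toLp_congr _ _ ?_
        filter_upwards [Lp.coeFn_smul c (f : L2R)] with x hx
        simp only [Submodule.coe_smul, Pi.smul_apply, hx, smul_eq_mul]
        ring }

section UnboundedOperators

variable {H : Type*} [NormedAddCommGroup H] [InnerProductSpace ℂ H]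

/-- The product `A B` of two unbounded operators, with its natural domain
`{f ∈ dom B : B f ∈ dom A}`. -/
def opComp (A B : H →ₗ.[ℂ] H) : H →ₗ.[ℂ] H where
  domain := (A.domain.comap B.toFun).map B.domain.subtype
  toFun :=
    { toFun := fun f => A ⟨B ⟨f.1, by
          obtain ⟨f, g, hg, rfl⟩ := f
          exact g.2⟩, by
          obtain ⟨f, g, hg, rfl⟩ := f
          exact hg⟩
      map_add' := by
        intro f g
        rw [← A.map_add]
        congr 1
        apply Subtype.ext
        exact B.map_add ⟨f.1, _⟩ ⟨g.1, _⟩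
      map_smul' := by
        intro c f
        rw [RingHom.id_apply, ← A.map_smul]
        congr 1
        apply Subtype.ext
        exact B.map_smul c ⟨f.1, _⟩ }

/-- The cube `A³ = A (A A)` of an unbounded operator, with its natural domain. -/
def opCube (A : H →ₗ.[ℂ] H) : H →ₗ.[ℂ] H := opComp A (opComp A A)

/-- `U t = e^{itA}` for all real `t`: `U` is the strongly continuous one-parameter unitary group
whose infinitesimal generator is `i A`. The last field says that `f ∈ dom A` and `A f = g` if and
only if `U t f` is differentiable at `t = 0` with derivative `i g`; in particular the domain of the
generator is exactly the domain of `A`. -/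
structure IsUnitaryExp [CompleteSpace H] (A : H →ₗ.[ℂ] H) (U : ℝ → H →L[ℂ] H) : Prop where
  unitary : ∀ t, U t ∈ unitary (H →L[ℂ] H)
  zero : U 0 = 1
  add : ∀ s t, U (s + t) = U s * U t
  continuous : ∀ f, Continuous fun t => U t f
  generator : ∀ f g, (∃ hf : f ∈ A.domain, A ⟨f, hf⟩ = g) ↔
    HasDerivAt (fun t => U t f) (Complex.I • g) 0

/-- The unbounded operator `A` has in the state `Φ` the characteristic function `φ`: the group
`e^{itA}` exists (equivalently, `A` is self-adjoint) and `⟪Φ, e^{itA} Φ⟫ = φ t` for all real `t`. -/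
def HasOpCharFun [CompleteSpace H] (A : H →ₗ.[ℂ] H) (Φ : H) (φ : ℝ → ℂ) : Prop :=
  (∃ U, IsUnitaryExp A U) ∧ ∀ U, IsUnitaryExp A U → ∀ t, inner ℂ Φ (U t Φ) = φ t

end UnboundedOperators

/-- The function `Φ(x) = π^{-1/4} e^{-x²/2}`. -/
def gaussFun (x : ℝ) : ℂ := (Real.pi ^ (-1 / 4 : ℝ) * Real.exp (-x ^ 2 / 2) : ℝ)

theorem memLp_gaussFun : MemLp gaussFun 2 (volume : Measure ℝ) := by
  have hc : Continuous gaussFun := by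
    unfold gaussFun
    fun_prop
  rw [memLp_two_iff_integrable_sq_norm hc.aestronglyMeasurable]
  refine ((integrable_exp_neg_mul_sq one_pos).const_mul
    ((Real.pi ^ (-1 / 4 : ℝ)) ^ 2)).congr (Filter.Eventually.of_forall fun x => ?_)
  simp only [gaussFun, Complex.norm_real, Real.norm_eq_abs, sq_abs, mul_pow, ← Real.exp_nat_mul]
  congr 2
  push_cast
  ring

/-- The Gaussian unit vector `Φ` of `L²(ℝ, ℂ)`. -/
def gaussVec : L2R := memLp_gaussFun.toLp gaussFun

/-- The operator `T = √2 X`. -/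
def opT : L2R →ₗ.[ℂ] L2R := ((Real.sqrt 2 : ℝ) : ℂ) • positionOp

/-- The function equal to `1` at `t = 0` and to
`(1 / (3 |t| √(6π))) e^{1/(108 t²)} K_{1/3}(1/(108 t²))` at `t ≠ 0`. -/
def cubeCharFun (t : ℝ) : ℝ :=
  if t = 0 then 1
  else 1 / (3 * |t| * Real.sqrt (6 * Real.pi)) * Real.exp (1 / (108 * t ^ 2)) *
    besselK (1 / 3) (1 / (108 * t ^ 2))

end

/-!
**Operator side.** For a measurable real function `m`, the multiplications by the phases `e^{itm}`
form a strongly continuous unitary group on `L²(ℝ, ℂ)` whose generator is `i m` on its maximal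
domain (`hasDerivAt_phaseMul_iff`). Both `T = √2 X` and its cube are such multiplication operators
with maximal domain (`isMulOp_opT`, `IsMulOp.opCube`). Any two unitary groups with the same generator
agree on its domain (`IsUnitaryExp.apply_eq`), and the domain contains `Φ`; since `|Φ|²` is the
density of `N(0, 1/2)`, the characteristic function of the operator in the state `Φ` is that of the
image of `N(0, 1/2)` under `m` (`IsMulOp.hasOpCharFun`). For `m = √2 x` this image is `N(0, 1)`, and
for `m = (√2 x)³` it is the law of the cube of an `N(0, 1)` variable.

**Analytic side.** It remains to compute `∫ e^{itx³ - x²/2} dx` for `t > 0`; negative `t` follows by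
conjugation. In the sector `0 ≤ √3 Im z ≤ |Re z|` the entire function `e^{itz³ - z²/2}` has Gaussian
decay (`norm_exp_cubic_le`), so the real line can be deformed into the path
`z(u) = (√3 sinh u + i (cosh u - 1)) / (6t)`, which lies in this sector
(`integral_path_eq_integral_re`). There the triple angle formula for `cosh` gives
`itz³ - z²/2 = κ - κ cosh 3u` with `κ = 1/(108t²)`, and the even part of `z'(u)` turns the integral
into `K_{1/3}(κ)` (`integral_exp_cubic`).
-/

/-! ### Uniqueness of the unitary group with a given generator -/

section Uniqueness

variable {H : Type*} [NormedAddCommGroup H] [InnerProductSpace ℂ H] [CompleteSpace H]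
  {A : H →ₗ.[ℂ] H} {U V : ℝ → H →L[ℂ] H}

theorem IsUnitaryExp.hasDerivAt (hU : IsUnitaryExp A U) (f : A.domain) (t : ℝ) :
    HasDerivAt (fun s => U s f) (Complex.I • U t (A f)) t := by
  have h0 : HasDerivAt (fun s => U s (f : H)) (Complex.I • A f) (t - t) := by
    rw [sub_self]
    exact (hU.generator f (A f)).1 ⟨f.2, rfl⟩
  have h1 := ((U t).restrictScalars ℝ).hasFDerivAt.comp_hasDerivAt t (h0.comp_sub_const t t)
  refine (h1.congr_deriv ?_).congr_of_eventuallyEq (Filter.Eventually.of_forall fun s => ?_)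
  · simp
  · have := hU.add t (s - t)
    rw [add_sub_cancel] at this
    simp [this]

theorem IsUnitaryExp.map_domain (hU : IsUnitaryExp A U) (f : A.domain) (t : ℝ) :
    ∃ h : U t f ∈ A.domain, A ⟨U t f, h⟩ = U t (A f) := by
  rw [hU.generator]
  refine ((((U t).restrictScalars ℝ).hasFDerivAt.comp_hasDerivAt (0 : ℝ)
    ((hU.generator f (A f)).1 ⟨f.2, rfl⟩)).congr_deriv (by simp)).congr_of_eventuallyEq
    (Filter.Eventually.of_forall fun s => ?_)
  have h := hU.add s t
  rw [add_comm, hU.add t s] at h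
  exact (DFunLike.congr_fun h (f : H)).symm

/-- The generator `i A` of a unitary group is skew-symmetric: differentiate the constant
`⟪U t f, U t f⟫` at `t = 0`. -/
theorem IsUnitaryExp.inner_add_inner_eq_zero (hU : IsUnitaryExp A U) (f : A.domain) :
    inner ℂ (f : H) (Complex.I • A f) + inner ℂ (Complex.I • A f) (f : H) = 0 := by
  have h0 := (hU.generator f (A f)).1 ⟨f.2, rfl⟩
  have h1 := h0.inner ℂ h0
  simp only [hU.zero, one_apply_eq_self] at h1
  refine h1.unique ((hasDerivAt_const (0 : ℝ) (inner ℂ (f : H) (f : H))).congr_of_eventuallyEq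
    (Filter.Eventually.of_forall fun t => ?_))
  exact ContinuousLinearMap.inner_map_map_of_mem_unitary (hU.unitary t) f f

/-- Two unitary groups with the same generator agree on its domain: the squared norm of
`U t f - V t f` has derivative zero, by skew-symmetry of the generator. -/
theorem IsUnitaryExp.apply_eq (hU : IsUnitaryExp A U) (hV : IsUnitaryExp A V) (f : A.domain)
    (t : ℝ) : U t f = V t f := by
  have hd : ∀ s, HasDerivAt (fun s => inner ℂ (U s (f : H) - V s f) (U s (f : H) - V s f)) 0 s := by
    intro s
    have h1 := (hU.hasDerivAt f s).sub (hV.hasDerivAt f s)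
    refine (h1.inner ℂ h1).congr_deriv ?_
    obtain ⟨hu, hu'⟩ := hU.map_domain f s
    obtain ⟨hv, hv'⟩ := hV.map_domain f s
    have h2 := hU.inner_add_inner_eq_zero (⟨U s f, hu⟩ - ⟨V s f, hv⟩)
    rw [A.map_sub, hu', hv', smul_sub] at h2
    exact h2
  have h := is_const_of_deriv_eq_zero (fun s => (hd s).differentiableAt) (fun s => (hd s).deriv) t 0
  simp only [hU.zero, hV.zero, sub_self, inner_zero_left] at h
  exact sub_eq_zero.1 (inner_self_eq_zero.1 h)

end Uniqueness

/-! ### Multiplication by phases -/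

/-- A form of dominated convergence in `L²`, for families given by representatives. -/
theorem tendsto_L2R_of_dominated {ι : Type*} {l : Filter ι} [l.IsCountablyGenerated]
    {F : ι → L2R} {G : L2R} {φ : ι → ℝ → ℂ} {b : ℝ → ℝ} (hb : MemLp b 2 volume)
    (hF : ∀ᶠ n in l, (F n - G : L2R) =ᵐ[volume] φ n)
    (hφ : ∀ᶠ n in l, ∀ᵐ x, ‖φ n x‖ ≤ b x)
    (hlim : ∀ᵐ x, Filter.Tendsto (fun n => φ n x) l (nhds 0)) :
    Filter.Tendsto F l (nhds G) := by
  rw [tendsto_iff_norm_sub_tendsto_zero]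
  have hsq : Filter.Tendsto (fun n => ∫ x, ‖φ n x‖ ^ 2) l (nhds (∫ _ : ℝ, (0 : ℝ))) := by
    refine tendsto_integral_filter_of_dominated_convergence (fun x => b x ^ 2) ?_ ?_
      hb.integrable_sq ?_
    · filter_upwards [hF] with n hn
      exact (((Lp.aestronglyMeasurable _).congr hn).norm.pow 2)
    · filter_upwards [hφ] with n hn
      filter_upwards [hn] with x hx
      rw [norm_pow, norm_norm]
      gcongr
    · filter_upwards [hlim] with x hx
      simpa using (hx.norm.pow 2)
  have hsqrt := (Real.continuous_sqrt.tendsto _).comp hsq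
  simp only [integral_zero, Real.sqrt_zero] at hsqrt
  refine hsqrt.congr' ?_
  filter_upwards [hF] with n hn
  rw [Function.comp_apply, Real.sqrt_eq_iff_mul_self_eq (by positivity) (by positivity), ← sq,
    ← @inner_self_eq_norm_sq ℂ, L2.inner_def, ← integral_re]
  · refine integral_congr_ae ?_
    filter_upwards [hn] with x hx
    rw [hx, inner_self_eq_norm_sq]
  · exact L2.integrable_inner _ _

theorem norm_exp_ofReal_mul_I_mul (r : ℝ) (z : ℂ) : ‖Complex.exp (r * Complex.I) * z‖ = ‖z‖ := by
  rw [norm_mul, Complex.norm_exp_ofReal_mul_I, one_mul]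

section PhaseMul

variable {m : ℝ → ℝ} (hm : Measurable m)
include hm

theorem memLp_phase_mul (t : ℝ) (f : L2R) :
    MemLp (fun x => Complex.exp ((t * m x : ℝ) * Complex.I) * f x) 2 volume := by
  refine (Lp.memLp f).of_le ?_ (Filter.Eventually.of_forall fun x => ?_)
  · exact Measurable.aestronglyMeasurable (by fun_prop) |>.mul (Lp.aestronglyMeasurable f)
  · exact (norm_exp_ofReal_mul_I_mul _ _).le

/-- Multiplication by the phase `e^{itm}` on `L²(ℝ, ℂ)`, for a measurable real function `m`. -/
noncomputable def phaseMul (t : ℝ) : L2R →L[ℂ] L2R :=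
  LinearMap.mkContinuous
    { toFun := fun f => (memLp_phase_mul hm t f).toLp _
      map_add' := by
        intro f g
        rw [← MemLp.toLp_add]
        refine MemLp.toLp_congr _ _ ?_
        filter_upwards [Lp.coeFn_add f g] with x hx
        simp only [Pi.add_apply, hx]
        ring
      map_smul' := by
        intro c f
        rw [RingHom.id_apply, ← MemLp.toLp_const_smul]
        refine MemLp.toLp_congr _ _ ?_
        filter_upwards [Lp.coeFn_smul c f] with x hx
        simp only [Pi.smul_apply, hx, smul_eq_mul]
        ring }
    1 fun f => by
      rw [one_mul, LinearMap.coe_mk, AddHom.coe_mk]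
      refine Lp.norm_le_norm_of_ae_le ?_
      filter_upwards [(memLp_phase_mul hm t f).coeFn_toLp] with x hx
      rw [hx]
      exact (norm_exp_ofReal_mul_I_mul _ _).le

theorem coeFn_phaseMul (t : ℝ) (f : L2R) :
    phaseMul hm t f =ᵐ[volume] fun x => Complex.exp ((t * m x : ℝ) * Complex.I) * f x :=
  (memLp_phase_mul hm t f).coeFn_toLp

theorem phaseMul_zero : phaseMul hm 0 = 1 := by
  ext1 f
  refine Lp.ext ?_
  filter_upwards [coeFn_phaseMul hm 0 f] with x hx
  simp [hx]

theorem phaseMul_add (s t : ℝ) : phaseMul hm (s + t) = phaseMul hm s * phaseMul hm t := by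
  ext1 f
  refine Lp.ext ?_
  rw [mul_apply_eq_comp]
  filter_upwards [coeFn_phaseMul hm (s + t) f, coeFn_phaseMul hm s (phaseMul hm t f),
    coeFn_phaseMul hm t f] with x h1 h2 h3
  rw [h1, h2, h3, ← mul_assoc, ← Complex.exp_add]
  push_cast
  ring_nf

theorem norm_phaseMul (t : ℝ) (f : L2R) : ‖phaseMul hm t f‖ = ‖f‖ := by
  refine le_antisymm (Lp.norm_le_norm_of_ae_le ?_) (Lp.norm_le_norm_of_ae_le ?_) <;>
  · filter_upwards [coeFn_phaseMul hm t f] with x hx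
    rw [hx, norm_exp_ofReal_mul_I_mul]

theorem phaseMul_mem_unitary (t : ℝ) : phaseMul hm t ∈ unitary (L2R →L[ℂ] L2R) := by
  have h1 : star (phaseMul hm t) * phaseMul hm t = 1 :=
    (ContinuousLinearMap.norm_map_iff_adjoint_comp_self _).1 (norm_phaseMul hm t)
  have h2 : phaseMul hm t * phaseMul hm (-t) = 1 := by
    rw [← phaseMul_add, add_neg_cancel, phaseMul_zero]
  refine ⟨h1, ?_⟩
  rwa [left_inv_eq_right_inv h1 h2]

theorem continuous_phaseMul (f : L2R) : Continuous fun t => phaseMul hm t f := by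
  refine continuous_iff_continuousAt.2 fun t₀ => ?_
  refine tendsto_L2R_of_dominated (φ := fun t x =>
      Complex.exp ((t * m x : ℝ) * Complex.I) * f x - Complex.exp ((t₀ * m x : ℝ) * Complex.I) * f x)
    (b := fun x => 2 * ‖f x‖) ((Lp.memLp f).norm.const_mul 2) ?_ ?_ ?_
  · refine Filter.Eventually.of_forall fun t => ?_
    filter_upwards [Lp.coeFn_sub (phaseMul hm t f) (phaseMul hm t₀ f), coeFn_phaseMul hm t f,
      coeFn_phaseMul hm t₀ f] with x h1 h2 h3
    rw [h1, Pi.sub_apply, h2, h3]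
  · refine Filter.Eventually.of_forall fun t => Filter.Eventually.of_forall fun x => ?_
    refine (norm_sub_le _ _).trans ?_
    rw [norm_exp_ofReal_mul_I_mul, norm_exp_ofReal_mul_I_mul, two_mul]
  · refine Filter.Eventually.of_forall fun x => ?_
    rw [tendsto_sub_nhds_zero_iff]
    exact Continuous.tendsto (by fun_prop) t₀

omit hm in
theorem hasDerivAt_phase (a : ℝ) (z : ℂ) :
    HasDerivAt (fun t : ℝ => Complex.exp ((t * a : ℝ) * Complex.I) * z)
      (Complex.I * (a * z)) 0 := by
  have h1 : HasDerivAt (fun t : ℝ => t * a) a 0 := by simpa using (hasDerivAt_id (0 : ℝ)).mul_const a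
  refine (((h1.ofReal_comp.mul_const Complex.I).cexp).mul_const z).congr_deriv ?_
  simp
  ring

theorem coeFn_slope_phaseMul (t : ℝ) (f : L2R) :
    (slope (fun t => phaseMul hm t f) 0 t : L2R) =ᵐ[volume]
      fun x => slope (fun t : ℝ => Complex.exp ((t * m x : ℝ) * Complex.I) * f x) 0 t := by
  simp only [slope_def_module, sub_zero]
  filter_upwards [Lp.coeFn_smul t⁻¹ (phaseMul hm t f - phaseMul hm 0 f),
    Lp.coeFn_sub (phaseMul hm t f) (phaseMul hm 0 f), coeFn_phaseMul hm t f,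
    coeFn_phaseMul hm 0 f] with x h1 h2 h3 h4
  rw [h1, Pi.smul_apply, h2, Pi.sub_apply, h3, h4]

/-- The generator of `t ↦ e^{itm}` is `i m`, on its maximal domain. If the difference quotients
converge in `L²`, then along a sequence they converge almost everywhere, which identifies the limit;
conversely they are dominated by `|m f|`. -/
theorem hasDerivAt_phaseMul_iff (f g : L2R) :
    HasDerivAt (fun t => phaseMul hm t f) (Complex.I • g) 0 ↔
      g =ᵐ[volume] fun x => (m x : ℂ) * f x := by
  rw [hasDerivAt_iff_tendsto_slope]
  constructor
  · intro h
    obtain ⟨s, hs, hlim⟩ := (tendstoInMeasure_of_tendsto_Lp h).exists_seq_tendsto_ae'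
    -- only the countably many times `s n` are used, so one null set serves them all
    have hall : ∀ᵐ x, ∀ n, (slope (fun t => phaseMul hm t f) 0 (s n) : L2R) x =
        slope (fun t : ℝ => Complex.exp ((t * m x : ℝ) * Complex.I) * f x) 0 (s n) :=
      ae_all_iff.2 fun n => coeFn_slope_phaseMul hm (s n) f
    filter_upwards [hlim, hall, Lp.coeFn_smul Complex.I g] with x h1 h2 h3
    have h4 := (hasDerivAt_iff_tendsto_slope.1 (hasDerivAt_phase (m x) (f x))).comp hs
    have h5 := tendsto_nhds_unique h1 (h4.congr fun n => (h2 n).symm)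
    rw [h3, Pi.smul_apply, smul_eq_mul] at h5
    exact mul_left_cancel₀ Complex.I_ne_zero h5
  · intro hg
    refine tendsto_L2R_of_dominated (φ := fun t x =>
        slope (fun t : ℝ => Complex.exp ((t * m x : ℝ) * Complex.I) * f x) 0 t -
          Complex.I * (m x * f x))
      (b := fun x => 2 * ‖g x‖) ((Lp.memLp g).norm.const_mul 2) ?_ ?_ ?_
    · refine Filter.Eventually.of_forall fun t => ?_
      filter_upwards [Lp.coeFn_sub (slope (fun t => phaseMul hm t f) 0 t) (Complex.I • g),
        coeFn_slope_phaseMul hm t f, Lp.coeFn_smul Complex.I g, hg] with x h1 h2 h3 h4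
      rw [h1, Pi.sub_apply, h2, h3, Pi.smul_apply, h4, smul_eq_mul]
    · refine Filter.Eventually.of_forall fun t => ?_
      filter_upwards [hg] with x hx
      refine (norm_sub_le _ _).trans ?_
      rw [hx, two_mul]
      gcongr
      · rcases eq_or_ne t 0 with rfl | ht
        · simp
          positivity
        · rw [slope_def_module, sub_zero, ← sub_mul, norm_smul, norm_mul, norm_inv, norm_mul,
            ← mul_assoc]
          gcongr
          rw [inv_mul_le_iff₀ (by positivity), zero_mul, Complex.ofReal_zero, zero_mul,
            Complex.exp_zero, mul_comm _ Complex.I, Complex.norm_real, ← norm_mul]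
          exact Real.norm_exp_I_mul_ofReal_sub_one_le
      · simp
    · refine Filter.Eventually.of_forall fun x => ?_
      rw [tendsto_sub_nhds_zero_iff]
      exact hasDerivAt_iff_tendsto_slope.1 (hasDerivAt_phase (m x) (f x))

end PhaseMul

/-! ### Multiplication operators with maximal domain -/

/-- `A` is the operator of multiplication by the function `m`, with its maximal domain: `f ∈ dom A`
and `A f = g` if and only if `g = m f` almost everywhere. -/
def IsMulOp (A : L2R →ₗ.[ℂ] L2R) (m : ℝ → ℝ) : Prop :=
  ∀ f g, (∃ hf : f ∈ A.domain, A ⟨f, hf⟩ = g) ↔ g =ᵐ[volume] fun x => (m x : ℂ) * f x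

theorem IsMulOp.isUnitaryExp {A : L2R →ₗ.[ℂ] L2R} {m : ℝ → ℝ} (hA : IsMulOp A m)
    (hm : Measurable m) : IsUnitaryExp A (phaseMul hm) where
  unitary := phaseMul_mem_unitary hm
  zero := phaseMul_zero hm
  add := phaseMul_add hm
  continuous := continuous_phaseMul hm
  generator f g := (hA f g).trans (hasDerivAt_phaseMul_iff hm f g).symm

theorem IsMulOp.mem_domain {A : L2R →ₗ.[ℂ] L2R} {m : ℝ → ℝ} (hA : IsMulOp A m) {f : L2R}
    (hf : MemLp (fun x => (m x : ℂ) * f x) 2 volume) : f ∈ A.domain :=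
  ((hA f (hf.toLp _)).2 hf.coeFn_toLp).1

theorem isMulOp_positionOp : IsMulOp positionOp fun x => x := by
  intro f g
  constructor
  · rintro ⟨hf, rfl⟩
    exact MemLp.coeFn_toLp (f := fun x : ℝ => (x : ℂ) * f x) hf
  · intro h
    have hf : MemLp (fun x : ℝ => (x : ℂ) * f x) 2 volume := (Lp.memLp g).ae_eq h
    refine ⟨hf, Lp.ext ?_⟩
    exact (MemLp.coeFn_toLp (f := fun x : ℝ => (x : ℂ) * f x) hf).trans h.symm

theorem isMulOp_opT : IsMulOp opT fun x => √2 * x := by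
  have h2 : ((√2 : ℝ) : ℂ) ≠ 0 := by simp
  intro f g
  constructor
  · rintro ⟨hf, rfl⟩
    have h := (isMulOp_positionOp f _).1 ⟨hf, rfl⟩
    filter_upwards [h, Lp.coeFn_smul ((√2 : ℝ) : ℂ) (positionOp ⟨f, hf⟩)] with x h1 h3
    refine h3.trans ?_
    rw [Pi.smul_apply, h1, smul_eq_mul]
    push_cast
    ring
  · intro h
    obtain ⟨hf, h'⟩ := (isMulOp_positionOp f (((√2 : ℝ) : ℂ)⁻¹ • g)).2 (by
      filter_upwards [h, Lp.coeFn_smul ((√2 : ℝ) : ℂ)⁻¹ g] with x h1 h3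
      rw [h3, Pi.smul_apply, h1, smul_eq_mul]
      push_cast
      field_simp)
    refine ⟨hf, ?_⟩
    change ((√2 : ℝ) : ℂ) • positionOp ⟨f, hf⟩ = g
    rw [h', smul_inv_smul₀ h2]

theorem opComp_graph {H : Type*} [NormedAddCommGroup H] [InnerProductSpace ℂ H]
    (A B : H →ₗ.[ℂ] H) (f g : H) :
    (∃ hf : f ∈ (opComp A B).domain, opComp A B ⟨f, hf⟩ = g) ↔
      ∃ h, (∃ hf : f ∈ B.domain, B ⟨f, hf⟩ = h) ∧ ∃ hh : h ∈ A.domain, A ⟨h, hh⟩ = g := by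
  constructor
  · rintro ⟨⟨f, hf, rfl⟩, rfl⟩
    exact ⟨B f, ⟨f.2, rfl⟩, hf, rfl⟩
  · rintro ⟨_, ⟨hf, rfl⟩, hh, rfl⟩
    exact ⟨⟨⟨f, hf⟩, hh, rfl⟩, rfl⟩

/-- The cube of a multiplication operator is multiplication by the cube, with maximal domain: from
`f, m³ f ∈ L²` it follows that `m f, m² f ∈ L²`. -/
theorem IsMulOp.opCube {A : L2R →ₗ.[ℂ] L2R} {m : ℝ → ℝ} (hA : IsMulOp A m) (hm : Measurable m) :
    IsMulOp (opCube A) fun x => m x ^ 3 := by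
  intro f g
  rw [_root_.opCube, opComp_graph]
  simp only [opComp_graph]
  constructor
  · rintro ⟨h, ⟨k, hk, hh⟩, hg⟩
    filter_upwards [(hA _ _).1 hk, (hA _ _).1 hh, (hA _ _).1 hg] with x h1 h2 h3
    rw [h3, h2, h1]
    push_cast
    ring
  · intro hg
    have hmem : ∀ n ≤ 3, MemLp (fun x => (m x : ℂ) ^ n * f x) 2 volume := by
      intro n hn
      refine ((Lp.memLp f).norm.add (Lp.memLp g).norm).of_le ?_ ?_
      · exact Measurable.aestronglyMeasurable (by fun_prop) |>.mul (Lp.aestronglyMeasurable f)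
      · filter_upwards [hg] with x hx
        rw [Pi.add_apply, hx, Real.norm_of_nonneg (by positivity), norm_mul, norm_mul,
          Complex.ofReal_pow, norm_pow, norm_pow]
        have h0 : 0 ≤ ‖(m x : ℂ)‖ := norm_nonneg _
        have : ‖(m x : ℂ)‖ ^ n ≤ 1 + ‖(m x : ℂ)‖ ^ 3 := by
          rcases le_total ‖(m x : ℂ)‖ 1 with h | h
          · exact (pow_le_one₀ h0 h).trans (by linarith [pow_nonneg h0 3])
          · exact (pow_le_pow_right₀ h hn).trans (by linarith)
        calc _ ≤ (1 + ‖(m x : ℂ)‖ ^ 3) * ‖f x‖ := by gcongr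
          _ = _ := by ring
    refine ⟨(hmem 2 (by norm_num)).toLp _, ⟨(hmem 1 (by norm_num)).toLp _, (hA _ _).2 ?_,
      (hA _ _).2 ?_⟩, (hA _ _).2 ?_⟩
    · filter_upwards [(hmem 1 (by norm_num)).coeFn_toLp] with x h1
      rw [h1, pow_one]
    · filter_upwards [(hmem 1 (by norm_num)).coeFn_toLp, (hmem 2 (by norm_num)).coeFn_toLp]
        with x h1 h2
      rw [h1, h2]
      ring
    · filter_upwards [(hmem 2 (by norm_num)).coeFn_toLp, hg] with x h1 h2
      rw [h1, h2]
      push_cast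
      ring

/-! ### Contour deformation for the cubic exponential integral -/

/-- **Deformation of the real line.** Let `f` be entire, and let `u ↦ p u + i q u` be a path. If
`f` is bounded by `M u`, with `M u * |q u| → 0`, on the vertical segment from `p u` to
`p u + i q u`, then the integrals of `f` along the path and along its real part agree: with a
primitive `G` of `f`, the difference of the integrands has primitive
`G (p u + i q u) - G (p u)`. -/
theorem integral_path_eq_integral_re {f : ℂ → ℂ} (hf : Differentiable ℂ f)
    {p q p' q' M : ℝ → ℝ} (hp : ∀ u, HasDerivAt p (p' u) u) (hq : ∀ u, HasDerivAt q (q' u) u)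
    (hM : ∀ u, ∀ s ∈ Set.Icc (0 : ℝ) 1, ‖f (p u + (s * q u : ℝ) * Complex.I)‖ ≤ M u)
    (hbot : Filter.Tendsto (fun u => M u * |q u|) Filter.atBot (nhds 0))
    (htop : Filter.Tendsto (fun u => M u * |q u|) Filter.atTop (nhds 0))
    (hi : Integrable fun u => f (p u + q u * Complex.I) * (p' u + q' u * Complex.I))
    (hi' : Integrable fun u => f (p u) * p' u) :
    ∫ u, f (p u + q u * Complex.I) * (p' u + q' u * Complex.I) = ∫ u, f (p u) * p' u := by
  obtain ⟨G, hG⟩ := hf.isExactOn_univ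
  have hderiv : ∀ u, HasDerivAt (fun u => G (p u + q u * Complex.I) - G (p u))
      (f (p u + q u * Complex.I) * (p' u + q' u * Complex.I) - f (p u) * p' u) u := fun u =>
    ((hG _ trivial).comp_of_eq u ((hp u).ofReal_comp.add
      ((hq u).ofReal_comp.mul_const Complex.I)) rfl).sub
      ((hG _ trivial).comp_of_eq u (hp u).ofReal_comp rfl)
  have hbound : ∀ u, ‖G (p u + q u * Complex.I) - G (p u)‖ ≤ M u * |q u| := by
    intro u
    have := (convex_segment (p u : ℂ) (p u + q u * Complex.I)).norm_image_sub_le_of_norm_hasDerivWithin_le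
      (f := G) (f' := f) (C := M u) (fun z _ => (hG z trivial).hasDerivWithinAt) ?_
      (left_mem_segment ℝ _ _) (right_mem_segment ℝ _ _)
    · simpa only [add_sub_cancel_left, norm_mul, Complex.norm_real, Complex.norm_I, mul_one,
        Real.norm_eq_abs] using this
    · intro z hz
      rw [segment_eq_image'] at hz
      obtain ⟨s, hs, rfl⟩ := hz
      refine le_trans (le_of_eq ?_) (hM u s hs)
      simp only [add_sub_cancel_left, Complex.real_smul, Complex.ofReal_mul, mul_assoc]
  have h := integral_of_hasDerivAt_of_tendsto hderiv (hi.sub hi')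
    (squeeze_zero_norm hbound hbot) (squeeze_zero_norm hbound htop)
  rw [integral_sub hi hi', sub_self] at h
  exact sub_eq_zero.1 h

section SinhSubstitution

variable {E : Type*} [NormedAddCommGroup E] [NormedSpace ℝ E]

theorem range_const_mul_sinh {c : ℝ} (hc : 0 < c) :
    Set.range (fun u => c * Real.sinh u) = Set.univ :=
  ((mul_left_surjective₀ hc.ne').comp Real.sinh_surjective).range_eq

theorem injective_const_mul_sinh {c : ℝ} (hc : 0 < c) :
    Function.Injective (fun u => c * Real.sinh u) :=
  (mul_right_injective₀ hc.ne').comp Real.sinh_injective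

theorem integral_comp_const_mul_sinh {c : ℝ} (hc : 0 < c) (g : ℝ → E) :
    ∫ u, (c * Real.cosh u) • g (c * Real.sinh u) = ∫ x, g x := by
  have h := integral_image_eq_integral_abs_deriv_smul (f := fun u => c * Real.sinh u)
    MeasurableSet.univ
    (fun u _ => ((Real.hasDerivAt_sinh u).const_mul c).hasDerivWithinAt)
    (injective_const_mul_sinh hc).injOn g
  rw [Set.image_univ, range_const_mul_sinh hc, setIntegral_univ, setIntegral_univ] at h
  rw [h]
  refine integral_congr_ae (Filter.Eventually.of_forall fun u => ?_)
  simp only [abs_of_pos (mul_pos hc (Real.cosh_pos u))]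

theorem MeasureTheory.Integrable.comp_const_mul_sinh {c : ℝ} (hc : 0 < c) {g : ℝ → E}
    (hg : Integrable g) : Integrable fun u => (c * Real.cosh u) • g (c * Real.sinh u) := by
  have h := (integrableOn_image_iff_integrableOn_abs_deriv_smul (f := fun u => c * Real.sinh u)
    MeasurableSet.univ
    (fun u _ => ((Real.hasDerivAt_sinh u).const_mul c).hasDerivWithinAt)
    (injective_const_mul_sinh hc).injOn g).1
  rw [Set.image_univ, range_const_mul_sinh hc, integrableOn_univ, integrableOn_univ] at h
  refine (h hg).congr (Filter.Eventually.of_forall fun u => ?_)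
  simp only [abs_of_pos (mul_pos hc (Real.cosh_pos u))]

end SinhSubstitution

/-- For `t ≥ 0` the function `e^{itz³ - z²/2}` has Gaussian decay in the sector
`0 ≤ √3 Im z ≤ |Re z|`. -/
theorem norm_exp_cubic_le {t x y : ℝ} (ht : 0 ≤ t) (hy : 0 ≤ y) (hxy : 3 * y ^ 2 ≤ x ^ 2) :
    ‖Complex.exp (Complex.I * t * (x + y * Complex.I) ^ 3 - (x + y * Complex.I) ^ 2 / 2)‖ ≤
      Real.exp (-(x ^ 2 / 3)) := by
  rw [Complex.norm_exp]
  have h : Complex.I * t * (x + y * Complex.I) ^ 3 - (x + y * Complex.I) ^ 2 / 2 =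
      ((-t * y * (3 * x ^ 2 - y ^ 2) - (x ^ 2 - y ^ 2) / 2 : ℝ) : ℂ) +
        ((t * (x ^ 3 - 3 * x * y ^ 2) - x * y : ℝ) : ℂ) * Complex.I := by
    push_cast
    linear_combination (t * (3 * x ^ 2 * y + 3 * x * y ^ 2 * Complex.I + y ^ 3 * (Complex.I ^ 2 - 1))
       - y ^ 2 / 2 : ℂ) * Complex.I_sq
  rw [h, Complex.add_re, Complex.re_ofReal_mul, Complex.ofReal_re, Complex.I_re, mul_zero, add_zero]
  refine Real.exp_le_exp.2 ?_
  have : 0 ≤ t * y * (3 * x ^ 2 - y ^ 2) := mul_nonneg (mul_nonneg ht hy) (by nlinarith)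
  linarith

/-- The integral of `e^{itx³ - x²/2}` over `ℝ`, moved onto the branch
`z = a (√3/2 · sinh u + i/2 · (cosh u - 1))`, `a = 1/(3t)`, of a hyperbola, which is the path of
steepest descent through `0`. -/
theorem integral_exp_cubic_eq_path {t : ℝ} (ht : 0 < t) :
    ∫ x : ℝ, Complex.exp (Complex.I * t * x ^ 3 - x ^ 2 / 2) =
      ∫ u : ℝ, Real.exp (1 / (108 * t ^ 2)) * Real.exp (-(1 / (108 * t ^ 2)) * Real.cosh (3 * u)) *
        ((1 / (6 * t) : ℝ) * (√3 * Real.cosh u + Real.sinh u * Complex.I)) := by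
  set f : ℂ → ℂ := fun z => Complex.exp (Complex.I * t * z ^ 3 - z ^ 2 / 2) with hfdef
  set b : ℝ := 1 / (6 * t) with hb
  have hb0 : 0 < b := by positivity
  have hbt : b * t = 1 / 6 := by rw [hb]; field_simp
  have h3 : √3 ^ 2 = 3 := Real.sq_sqrt (by norm_num)
  have h30 : 0 < √3 := by positivity
  set c : ℝ := b * √3 with hc
  have hc0 : 0 < c := by positivity
  set p : ℝ → ℝ := fun u => c * Real.sinh u with hp
  set q : ℝ → ℝ := fun u => b * (Real.cosh u - 1) with hq
  have hq0 : ∀ u, 0 ≤ q u := fun u => mul_nonneg hb0.le (by linarith [Real.one_le_cosh u])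
  -- the path lies in the sector where the integrand has Gaussian decay
  have hpq : ∀ u, 3 * q u ^ 2 ≤ p u ^ 2 := by
    intro u
    have : p u ^ 2 - 3 * q u ^ 2 = 6 * b ^ 2 * (Real.cosh u - 1) := by
      simp only [hp, hq, hc, mul_pow, h3, Real.sinh_sq]
      ring
    have h1 : 0 ≤ 6 * b ^ 2 * (Real.cosh u - 1) :=
      mul_nonneg (by positivity) (by linarith [Real.one_le_cosh u])
    linarith
  have hf : Differentiable ℂ f := by
    rw [hfdef]; fun_prop
  have hM : ∀ u, ∀ s ∈ Set.Icc (0 : ℝ) 1,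
      ‖f (p u + (s * q u : ℝ) * Complex.I)‖ ≤ Real.exp (-(p u ^ 2 / 3)) := by
    intro u s hs
    refine norm_exp_cubic_le ht.le (mul_nonneg hs.1 (hq0 u)) (le_trans ?_ (hpq u))
    have : s * q u ≤ q u := mul_le_of_le_one_left (hq0 u) hs.2
    have := mul_nonneg hs.1 (hq0 u)
    gcongr
  have hqp : ∀ u, |q u| ≤ |p u| := fun u => sq_le_sq.1 (by nlinarith [hpq u, sq_nonneg (q u)])
  have hgauss : Integrable fun x : ℝ => Real.exp (-(x ^ 2 / 3)) := by
    refine (integrable_exp_neg_mul_sq (b := 1 / 3) (by norm_num)).congr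
      (Filter.Eventually.of_forall fun x => ?_)
    simp only
    congr 1
    ring
  have hlim : Filter.Tendsto (fun x : ℝ => Real.exp (-(x ^ 2 / 3)) * |x|)
      (Filter.cocompact ℝ) (nhds 0) := by
    have := tendsto_rpow_abs_mul_exp_neg_mul_sq_cocompact (a := 1 / 3) (by norm_num) 1
    refine this.congr fun x => ?_
    rw [Real.rpow_one, mul_comm]
    congr 2
    ring
  have hptop : Filter.Tendsto p Filter.atTop Filter.atTop :=
    Real.sinhOrderIso.tendsto_atTop.const_mul_atTop hc0
  have hpbot : Filter.Tendsto p Filter.atBot Filter.atBot :=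
    Real.sinhOrderIso.tendsto_atBot.const_mul_atBot hc0
  have hle : ∀ u, Real.exp (-(p u ^ 2 / 3)) * |q u| ≤ Real.exp (-(p u ^ 2 / 3)) * |p u| :=
    fun u => mul_le_mul_of_nonneg_left (hqp u) (Real.exp_pos _).le
  have hint := hgauss.comp_const_mul_sinh hc0
  have key := integral_path_eq_integral_re hf (p := p) (q := q)
    (p' := fun u => c * Real.cosh u) (q' := fun u => b * Real.sinh u)
    (fun u => (Real.hasDerivAt_sinh u).const_mul c)
    (fun u => ((Real.hasDerivAt_cosh u).sub_const 1).const_mul b) hM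
    (squeeze_zero (fun u => by positivity) hle
      (hlim.comp (hpbot.mono_right atBot_le_cocompact)))
    (squeeze_zero (fun u => by positivity) hle
      (hlim.comp (hptop.mono_right atTop_le_cocompact)))
    ?_ ?_
  · have hleft := integral_comp_const_mul_sinh hc0 (fun x : ℝ => f x)
    rw [show (∫ x : ℝ, Complex.exp (Complex.I * t * x ^ 3 - x ^ 2 / 2)) = ∫ x : ℝ, f x from rfl,
      ← hleft]
    refine Eq.trans ?_ (key.symm.trans ?_)
    · refine integral_congr_ae (Filter.Eventually.of_forall fun u => ?_)
      simp only [Complex.real_smul, hp]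
      ring
    · refine integral_congr_ae (Filter.Eventually.of_forall fun u => ?_)
      simp only [hfdef]
      rw [Complex.ofReal_exp, Complex.ofReal_exp, ← Complex.exp_add]
      congr 1
      · congr 1
        have hz : 1 / (108 * t ^ 2) = b ^ 2 / 3 := by rw [hb]; field_simp; norm_num
        have hbt' : (b : ℂ) * t = 1 / 6 := by rw [← Complex.ofReal_mul, hbt]; norm_num
        have h3' : (√3 : ℂ) ^ 2 = 3 := by exact_mod_cast h3
        have hS := Complex.cosh_sq (u : ℂ)
        rw [hz]
        simp only [hp, hq, hc]
        push_cast
        rw [Complex.cosh_three_mul]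
        have hI := Complex.I_sq
        generalize Complex.sinh u = S at *
        generalize Complex.cosh u = C at *
        generalize (√3 : ℂ) = r at *
        -- the exponent on the path, divided by `b ^ 2 / 6`; this is where the hyperbola and the
        -- triple angle formula for `cosh` match
        have key : Complex.I * (r * S + (C - 1) * Complex.I) ^ 3 -
            3 * (r * S + (C - 1) * Complex.I) ^ 2 = 2 * (1 - (4 * C ^ 3 - 3 * C)) := by
          grind
        linear_combination (b : ℂ) ^ 2 * Complex.I * (r * S + (C - 1) * Complex.I) ^ 3 * hbt' +
          (b : ℂ) ^ 2 / 6 * key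
      · simp only [hc]
        push_cast
        ring
  · refine (hint.const_mul 2).mono' ?_ (Filter.Eventually.of_forall fun u => ?_)
    · refine Continuous.aestronglyMeasurable ?_
      have := hf.continuous
      fun_prop
    · rw [norm_mul]
      have h1 := hM u 1 (by simp)
      rw [one_mul] at h1
      have h2 : ‖((c * Real.cosh u : ℝ) : ℂ) + (b * Real.sinh u : ℝ) * Complex.I‖ ≤
          2 * (c * Real.cosh u) := by
        refine (norm_add_le _ _).trans ?_
        rw [norm_mul, Complex.norm_I, mul_one, Complex.norm_real, Complex.norm_real,
          Real.norm_of_nonneg (mul_nonneg hc0.le (Real.cosh_pos u).le), two_mul, norm_mul,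
          Real.norm_of_nonneg hb0.le, Real.norm_eq_abs]
        gcongr
        · rw [hc]
          refine le_mul_of_one_le_right hb0.le (Real.one_le_sqrt.2 (by norm_num))
        · refine abs_le_of_sq_le_sq ?_ (Real.cosh_pos u).le
          rw [Real.cosh_sq]
          linarith
      calc _ ≤ Real.exp (-(p u ^ 2 / 3)) * (2 * (c * Real.cosh u)) := by gcongr
        _ = _ := by rw [smul_eq_mul]; ring
  · refine hint.mono' ?_ (Filter.Eventually.of_forall fun u => ?_)
    · refine Continuous.aestronglyMeasurable ?_
      have := hf.continuous
      fun_prop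
    · rw [norm_mul, Complex.norm_real,
        Real.norm_of_nonneg (mul_nonneg hc0.le (Real.cosh_pos u).le), mul_comm, smul_eq_mul]
      have h1 := hM u 0 (by simp)
      rw [zero_mul, Complex.ofReal_zero, zero_mul, add_zero] at h1
      exact mul_le_mul_of_nonneg_left h1 (mul_nonneg hc0.le (Real.cosh_pos u).le)

/-! ### Evaluation by the Bessel function -/

theorem integrable_exp_neg_mul_cosh_mul_cosh {z : ℝ} (hz : 0 < z) :
    Integrable fun u => Real.exp (-z * Real.cosh (3 * u)) * Real.cosh u := by
  refine ((integrable_exp_neg_mul_sq hz).comp_const_mul_sinh one_pos).mono' ?_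
    (Filter.Eventually.of_forall fun u => ?_)
  · exact Continuous.aestronglyMeasurable (by fun_prop)
  · have hC := Real.one_le_cosh u
    have h : Real.sinh u ^ 2 ≤ Real.cosh (3 * u) := by
      rw [Real.cosh_three_mul, Real.sinh_sq]
      nlinarith [mul_nonneg (sub_nonneg.2 hC) (sq_nonneg (Real.cosh u)), sq_nonneg (Real.cosh u - 1)]
    rw [Real.norm_of_nonneg (by positivity), smul_eq_mul, one_mul, one_mul, mul_comm (Real.cosh u)]
    gcongr ?_ * _
    exact Real.exp_le_exp.2 (by nlinarith)

theorem integral_exp_neg_mul_cosh_mul_cosh (z : ℝ) :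
    ∫ u, Real.exp (-z * Real.cosh (3 * u)) * Real.cosh u = 2 / 3 * besselK (1 / 3) z := by
  have h1 := integral_comp_abs (f := fun u => Real.exp (-z * Real.cosh (3 * u)) * Real.cosh u)
  have h2 := integral_comp_mul_left_Ioi
    (fun w => Real.exp (-z * Real.cosh w) * Real.cosh (1 / 3 * w)) 0 (b := 3) (by norm_num)
  rw [mul_zero, smul_eq_mul, ← besselK] at h2
  have h3 : ∀ u : ℝ, Real.exp (-z * Real.cosh (3 * |u|)) * Real.cosh |u| =
      Real.exp (-z * Real.cosh (3 * u)) * Real.cosh u := by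
    intro u
    rw [Real.cosh_abs, ← Real.cosh_abs (3 * u), abs_mul, abs_of_pos (by norm_num : (0 : ℝ) < 3)]
  simp only [h3] at h1
  rw [h1]
  have h4 : ∀ u : ℝ, 1 / 3 * (3 * u) = u := fun u => by ring
  simp only [h4] at h2
  rw [h2]
  ring

/-- On the path of steepest descent the `cosh` part gives the Bessel function, while the `sinh` part
is odd and integrates to zero. -/
theorem integral_exp_cubic {t : ℝ} (ht : 0 < t) :
    ∫ x : ℝ, Complex.exp (Complex.I * t * x ^ 3 - x ^ 2 / 2) =
      (√3 / (9 * t) * Real.exp (1 / (108 * t ^ 2)) * besselK (1 / 3) (1 / (108 * t ^ 2)) : ℝ) := by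
  rw [integral_exp_cubic_eq_path ht]
  set z : ℝ := 1 / (108 * t ^ 2) with hz
  have hz0 : 0 < z := by positivity
  have hc := integrable_exp_neg_mul_cosh_mul_cosh hz0
  have hs : Integrable fun u => Real.exp (-z * Real.cosh (3 * u)) * Real.sinh u := by
    refine hc.mono' (Continuous.aestronglyMeasurable (by fun_prop))
      (Filter.Eventually.of_forall fun u => ?_)
    rw [norm_mul, Real.norm_of_nonneg (Real.exp_pos _).le]
    gcongr
    refine abs_le_of_sq_le_sq ?_ (Real.cosh_pos u).le
    rw [Real.cosh_sq]
    linarith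
  have hs0 : ∫ u, Real.exp (-z * Real.cosh (3 * u)) * Real.sinh u = 0 := by
    have h := integral_neg_eq_self (fun u => Real.exp (-z * Real.cosh (3 * u)) * Real.sinh u) volume
    simp only [mul_neg, Real.cosh_neg, Real.sinh_neg, integral_neg] at h
    linarith
  have hsplit : ∀ u : ℝ, (Real.exp z * Real.exp (-z * Real.cosh (3 * u)) *
      ((1 / (6 * t) : ℝ) * (√3 * Real.cosh u + Real.sinh u * Complex.I)) : ℂ) =
      (Real.exp z * (1 / (6 * t)) * √3 : ℝ) *
        (Real.exp (-z * Real.cosh (3 * u)) * Real.cosh u : ℝ) +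
      ((Real.exp z * (1 / (6 * t)) : ℝ) * Complex.I) *
        (Real.exp (-z * Real.cosh (3 * u)) * Real.sinh u : ℝ) := by
    intro u
    push_cast
    ring
  simp only [hsplit]
  rw [integral_add (hc.ofReal.const_mul _) (hs.ofReal.const_mul _), integral_const_mul,
    integral_const_mul, integral_complex_ofReal, integral_complex_ofReal, hs0,
    integral_exp_neg_mul_cosh_mul_cosh, Complex.ofReal_zero, mul_zero, add_zero,
    ← Complex.ofReal_mul]
  congr 1
  field_simp
  ring

theorem charFun_map_pow_three_gaussianReal (t : ℝ) :
    charFun ((gaussianReal 0 1).map (· ^ 3)) t = (cubeCharFun t : ℂ) := by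
  have hpos : ∀ t : ℝ, 0 < t →
      charFun ((gaussianReal 0 1).map (· ^ 3)) t = (cubeCharFun t : ℂ) := by
    intro t ht
    rw [charFun_apply_real, integral_map (by fun_prop)
      (Continuous.aestronglyMeasurable (by fun_prop)), integral_gaussianReal_eq_integral_smul
      one_ne_zero]
    have h : ∀ x : ℝ, gaussianPDFReal 0 1 x • Complex.exp (t * (x ^ 3 : ℝ) * Complex.I) =
        ((√(2 * Real.pi))⁻¹ : ℝ) * Complex.exp (Complex.I * t * x ^ 3 - x ^ 2 / 2) := by
      intro x
      rw [gaussianPDFReal, Complex.real_smul, Complex.ofReal_mul, mul_assoc, Complex.ofReal_exp,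
        ← Complex.exp_add]
      congr 2
      · simp
      · push_cast
        ring
    simp only [h]
    rw [integral_const_mul, integral_exp_cubic ht, ← Complex.ofReal_mul, cubeCharFun,
      if_neg ht.ne', abs_of_pos ht]
    congr 1
    have h6 : √(6 * Real.pi) = √3 * √(2 * Real.pi) := by
      rw [← Real.sqrt_mul (by norm_num)]
      ring_nf
    have h3 : √3 ^ 2 = 3 := Real.sq_sqrt (by norm_num)
    rw [h6]
    field_simp
    rw [h3]
    norm_num
  rcases lt_trichotomy t 0 with h | rfl | h
  · have hneg := hpos (-t) (neg_pos.2 h)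
    rw [charFun_neg] at hneg
    rw [← Complex.conj_conj (charFun _ t), hneg, Complex.conj_ofReal]
    simp [cubeCharFun]
  · have := Measure.isProbabilityMeasure_map (μ := gaussianReal 0 1) (f := fun x : ℝ => x ^ 3)
      (by fun_prop)
    simp [cubeCharFun]
  · exact hpos t h

/-! ### Distribution in the Gaussian state -/

theorem memLp_pow_mul_gaussFun (n : ℕ) :
    MemLp (fun x => (((√2 * x) ^ n : ℝ) : ℂ) * gaussFun x) 2 volume := by
  have hc : Continuous fun x => (((√2 * x) ^ n : ℝ) : ℂ) * gaussFun x := by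
    unfold gaussFun
    fun_prop
  rw [memLp_two_iff_integrable_sq_norm hc.aestronglyMeasurable]
  refine ((integrable_rpow_mul_exp_neg_mul_sq one_pos (s := (2 * n : ℕ)) (by
    have : (0 : ℝ) ≤ (2 * n : ℕ) := Nat.cast_nonneg _
    linarith)).const_mul (√2 ^ (2 * n) * (Real.pi ^ (-1 / 4 : ℝ)) ^ 2)).congr
    (Filter.Eventually.of_forall fun x => ?_)
  simp only [gaussFun, ← Complex.ofReal_mul, Complex.norm_real, Real.norm_eq_abs, sq_abs, mul_pow,
    ← Real.exp_nat_mul, Real.rpow_natCast]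
  rw [show ((2 : ℕ) : ℝ) * (-x ^ 2 / 2) = -1 * x ^ 2 by push_cast; ring]
  ring

theorem gaussFun_normSq (x : ℝ) :
    star (gaussFun x) * gaussFun x = (gaussianPDFReal 0 (1 / 2) x : ℂ) := by
  have hpi : (Real.pi ^ (-1 / 4 : ℝ)) * (Real.pi ^ (-1 / 4 : ℝ)) = (√Real.pi)⁻¹ := by
    rw [← Real.rpow_add Real.pi_pos, Real.sqrt_eq_rpow, ← Real.rpow_neg Real.pi_pos.le]
    norm_num
  have hreal : star (gaussFun x) = gaussFun x := Complex.conj_ofReal _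
  rw [hreal, gaussFun, ← Complex.ofReal_mul, mul_mul_mul_comm, hpi, ← Real.exp_add,
    gaussianPDFReal]
  congr 2
  · push_cast
    congr 2
    ring
  · push_cast
    congr 1
    ring

/-- In the state `Φ`, multiplication by `m` has the distribution of `m` under the probability
density `|Φ|²`, which is that of `N(0, 1/2)`. Unitary groups with the given generator are compared
with `e^{itm}` at the vector `Φ` only, so it is enough that `Φ` lies in the domain. -/
theorem IsMulOp.hasOpCharFun {A : L2R →ₗ.[ℂ] L2R} {m : ℝ → ℝ} (hA : IsMulOp A m)
    (hm : Measurable m) (hΦ : MemLp (fun x => (m x : ℂ) * gaussFun x) 2 volume) :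
    HasOpCharFun A gaussVec (charFun ((gaussianReal 0 (1 / 2)).map m)) := by
  have hcoe : gaussVec =ᵐ[volume] gaussFun := memLp_gaussFun.coeFn_toLp
  have hdom : gaussVec ∈ A.domain := hA.mem_domain (hΦ.ae_eq (by
    filter_upwards [hcoe] with x hx
    rw [hx]))
  refine ⟨⟨_, hA.isUnitaryExp hm⟩, fun U hU t => ?_⟩
  rw [hU.apply_eq (hA.isUnitaryExp hm) ⟨gaussVec, hdom⟩ t, L2.inner_def, charFun_apply_real,
    integral_map hm.aemeasurable (Measurable.aestronglyMeasurable (by fun_prop)),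
    integral_gaussianReal_eq_integral_smul (by norm_num)]
  refine integral_congr_ae ?_
  filter_upwards [coeFn_phaseMul hm t gaussVec, hcoe] with x h1 h2
  rw [h1, h2, Complex.real_smul, ← gaussFun_normSq, RCLike.inner_apply, Complex.ofReal_mul]
  simp only [starRingEnd_apply]
  ring

theorem map_sqrt_two_mul_gaussianReal :
    (gaussianReal 0 (1 / 2)).map (fun x => √2 * x) = gaussianReal 0 1 := by
  rw [gaussianReal_map_const_mul, mul_zero]
  congr 1
  ext
  simp

theorem corollary2p4 :
    -- the operator `T = √2 X` is `N(0,1)`-distributed in the state `Φ`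
    HasOpCharFun opT gaussVec (charFun (gaussianReal 0 1)) ∧
    -- the characteristic function of the operator `T³` in the state `Φ`
    HasOpCharFun (opCube opT) gaussVec (fun t => (cubeCharFun t : ℂ)) ∧
    -- the same for the cube of every classical `N(0,1)`-distributed random variable
    (∀ {Ω : Type*} [MeasurableSpace Ω] (P : Measure Ω) (Z : Ω → ℝ), HasLaw Z (gaussianReal 0 1) P →
      ∀ t : ℝ, charFun (P.map (fun ω => Z ω ^ 3)) t = (cubeCharFun t : ℂ)) := by
  refine ⟨?_, ?_, ?_⟩
  · rw [← map_sqrt_two_mul_gaussianReal]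
    exact isMulOp_opT.hasOpCharFun (by fun_prop) (by simpa using memLp_pow_mul_gaussFun 1)
  · have h := (isMulOp_opT.opCube (by fun_prop)).hasOpCharFun (by fun_prop)
      (memLp_pow_mul_gaussFun 3)
    have hmap : (gaussianReal 0 (1 / 2)).map (fun x => (√2 * x) ^ 3) =
        (gaussianReal 0 1).map (· ^ 3) := by
      rw [← map_sqrt_two_mul_gaussianReal, Measure.map_map (by fun_prop) (by fun_prop)]
      rfl
    rw [hmap, funext charFun_map_pow_three_gaussianReal] at h
    exact h
  · intro Ω _ P Z hZ t
    rw [← charFun_map_pow_three_gaussianReal, ← hZ.map_eq,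
      AEMeasurable.map_map_of_aemeasurable (by fun_prop) hZ.aemeasurable]
    rfl
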